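/- Let $E$ be a finite-dimensional real Euclidean space with scalar product $\langle\cdot,\cdot\rangle$, and let $R\subset E$ be an irreducible reduced crystallographic root system spanning $E$, with Weyl group $W$ generated by the orthogonal reflections in the hyperplanes perpendicular to the roots. For $\alpha\in R$ put $\alpha^\vee=2\alpha/\langle\alpha,\alpha\rangle$. Fix a system $R_+$ of positive roots, and let $R_+^{(s)}$ and $R_+^{(l)}$ be the sets of short and of long positive roots (if all roots have the same length, they are all called short, and $R_+^{(l)}=\emptyset$). Let $$\mathcal P_+=\{\lambda\in E \mid \langle\lambda,\alpha^\vee\rangle\in\mathbb Z\ \forall\alpha\in R,\ \langle\lambda,\alpha^\vee\rangle\ge 0\ \forall\alpha\in R_+\}$$ be the set of dominant weights, and put, for $\lambda\in\mathcal P_+$, $$m^{(s)}(\lambda)=\min_{\alpha\in R_+^{(s)}}\langle\lambda,\alpha^\vee\rangle,\quad m^{(l)}(\lambda)=\min_{\alpha\in R_+^{(l)}}\langle\lambda,\alpha^\vee\rangle,\quad \rho^{(s)}=\tfrac12\sum_{\alpha\in R_+^{(s)}}\alpha,\quad \rho^{(l)}=\tfrac12\sum_{\alpha\in R_+^{(l)}}\alpha,$$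 where the minimum over the empty set is $+\infty$. For $w\in W$ let $S_w=\{\alpha\in R_+\mid w(\alpha)\notin R_+\}$. **Proposition.** Let $\lambda\in\mathcal P_+$ be strongly dominant, i.e. $m^{(s)}(\lambda)>0$ and $m^{(l)}(\lambda)>0$. Let $m^{(s)},m^{(l)}$ be real numbers with $0<m^{(s)}\le m^{(s)}(\lambda)$ and $0<m^{(l)}\le m^{(l)}(\lambda)$, and let $n_\alpha$, $\alpha\in R_+$, be integers with $0\le n_\alpha\le m^{(s)}$ for all $\alpha\in R_+^{(s)}$ and $0\le n_\alpha\le m^{(l)}$ for all $\alpha\in R_+^{(l)}$. Put $\tilde\lambda=\lambda-m^{(s)}\rho^{(s)}-m^{(l)}\rho^{(l)}$. Then $\lambda-\sum_{\alpha\in R_+}n_\alpha\alpha$ lies in the orbit $W(\lambda)$ if and only if there is a $w\in W$ with $w(\tilde\lambda)=\tilde\lambda$ such that $$\lambda-\sum_{\alpha\in R_+}n_\alpha\alpha=\lambda-m^{(s)}\sum_{\alpha\in S_w\cap R_+^{(s)}}\alpha-m^{(l)}\sum_{\alpha\in S_w\cap R_+^{(l)}}\alpha .$$ -/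

import Mathlib

noncomputable section

open scoped Classical

namespace RootPairing

variable {ι E : Type*} [Fintype ι] [NormedAddCommGroup E] [InnerProductSpace ℝ E]

/-- `P` is a root pairing inside the Euclidean space `E`: the pairing between `E` (home of the
roots) and `E` (home of the coroots) is the scalar product, and `α^∨ = 2 α / ⟨α, α⟩`. Hence the
reflections `P.reflection i` are the orthogonal reflections `x ↦ x - ⟨x, α^∨⟩ α`, which generate
the Weyl group. -/
structure IsEuclidean (P : RootPairing ι ℝ E E) : Prop where
  toLinearMap_apply (x y : E) : P.toLinearMap x y = inner ℝ x y
  coroot_eq (i : ι) : P.coroot i = (2 / inner ℝ (P.root i) (P.root i) : ℝ) • P.root i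

/-- The root with index `i` is short: it has minimal length among all roots. In particular all
roots are short if the system is simply laced. -/
def IsShortRoot (P : RootPairing ι ℝ E E) (i : ι) : Prop :=
  ∀ j, ‖P.root i‖ ≤ ‖P.root j‖

/-- The weight lattice `{x ∈ E | ⟨x, α^∨⟩ ∈ ℤ for all roots α}`. -/
def weightLattice (P : RootPairing ι ℝ E E) : Set E :=
  {x | ∀ i, ∃ z : ℤ, inner ℝ x (P.coroot i) = (z : ℝ)}

section Positive

variable {P : RootPairing ι ℝ E E} (b : P.Base)

/-- The dominant weights: the `x` in the weight lattice with `⟨x, α^∨⟩ ∈ ℕ` for all positive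
roots `α`. -/
def dominantWeights : Set E :=
  {x | x ∈ P.weightLattice ∧ ∀ i, b.IsPos i → ∃ n : ℕ, inner ℝ x (P.coroot i) = (n : ℝ)}

/-- (Indices of) the positive roots. -/
def posRoots : Finset ι := {i | b.IsPos i}

/-- (Indices of) the short positive roots. -/
def shortPosRoots : Finset ι := {i ∈ posRoots b | P.IsShortRoot i}

/-- (Indices of) the long positive roots, that is, the positive roots that are not short. -/
def longPosRoots : Finset ι := {i ∈ posRoots b | ¬ P.IsShortRoot i}

/-- The minimum of `⟨x, α^∨⟩` over the short positive roots `α`. -/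
def minShort (x : E) : WithTop ℝ :=
  (shortPosRoots b).inf fun i ↦ ((inner ℝ x (P.coroot i) : ℝ) : WithTop ℝ)

/-- The minimum of `⟨x, α^∨⟩` over the long positive roots `α`; it is `⊤` (that is, `+∞`) if there
are no long roots. -/
def minLong (x : E) : WithTop ℝ :=
  (longPosRoots b).inf fun i ↦ ((inner ℝ x (P.coroot i) : ℝ) : WithTop ℝ)

/-- A dominant weight is strongly dominant if both of its distances to the walls are positive. -/
def IsStronglyDominant (x : E) : Prop :=
  x ∈ dominantWeights b ∧ 0 < minShort b x ∧ 0 < minLong b x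

/-- The half-sum of the short positive roots. -/
def rhoShort : E := (1 / 2 : ℝ) • ∑ i ∈ shortPosRoots b, P.root i

/-- The half-sum of the long positive roots. -/
def rhoLong : E := (1 / 2 : ℝ) • ∑ i ∈ longPosRoots b, P.root i

/-- (Indices of) the inversion set `S_w`: the positive roots `α` such that `w(α)` is not a
positive root. -/
def inversionSet (w : P.weylGroup) : Finset ι :=
  {i ∈ posRoots b | w • P.root i ∉ P.root '' {j | b.IsPos j}}

end Positive

end RootPairing

end

namespace RootPairing

section InvariantWeights

variable {ι E : Type*} [NormedAddCommGroup E] [InnerProductSpace ℝ E]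
  {P : RootPairing ι ℝ E E}

/-! Both lengths are treated at once by a Weyl-invariant weight `c` on the roots, with half-sum ρ =
`weightedRho b c`. Two facts carry the proof: ρ - w⁻¹ρ is the `c`-weighted sum over `inversionSet b
w`, and y = x - ρ is dominant because ρ pairs to `c j` with each simple coroot. If w⁻¹x = x - ∑ n_α
α, subtracting the first fact and applying w writes wy - y as a combination of the wα. The
coefficient is n_α ≥ 0 when wα is positive and n_α - c_α ≤ 0 when wα is negative, so ⟨y, wy - y⟩ ≥
0. As w is an isometry, this forces wy = y; then x - w⁻¹x = ρ - w⁻¹ρ, which is the asserted formula.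
The converse reads the last identity backwards. -/

lemma IsEuclidean.inner_weylGroup_smul_smul (hP : P.IsEuclidean) (g : P.weylGroup) (x y : E) :
    inner ℝ (g • x) (g • y) = (inner ℝ x y : ℝ) := by
  revert x y
  obtain ⟨g, hg⟩ := g
  induction hg using weylGroup.induction with
  | mem i =>
    intro x y
    have key (z : E) : (⟨Equiv.reflection P i, P.reflection_mem_weylGroup i⟩ : P.weylGroup) • z =
        z - (inner ℝ z (P.coroot i) : ℝ) • P.root i := by
      rw [← hP.toLinearMap_apply]
      exact P.reflection_apply i z
    have h0 : (inner ℝ (P.root i) (P.root i) : ℝ) ≠ 0 := inner_self_ne_zero.mpr (P.ne_zero i)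
    rw [key, key, hP.coroot_eq]
    simp only [inner_sub_left, inner_sub_right, real_inner_smul_left, real_inner_smul_right,
      real_inner_comm (P.root i)]
    field_simp
    ring
  | one => simp
  | mul g₁ g₂ hg₁ hg₂ hg₁' hg₂' =>
    intro x y
    rw [← Submonoid.mk_mul_mk _ _ _ hg₁ hg₂, mul_smul, mul_smul, hg₁', hg₂']

lemma IsEuclidean.norm_root_weylGroupToPerm (hP : P.IsEuclidean) (g : P.weylGroup) (i : ι) :
    ‖P.root (P.weylGroupToPerm g i)‖ = ‖P.root i‖ := by
  rw [← weylGroup_apply_root, ← sq_eq_sq₀ (norm_nonneg _) (norm_nonneg _),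
    ← real_inner_self_eq_norm_sq, ← real_inner_self_eq_norm_sq, hP.inner_weylGroup_smul_smul]

lemma IsEuclidean.isShortRoot_weylGroupToPerm_iff (hP : P.IsEuclidean) (g : P.weylGroup) (i : ι) :
    P.IsShortRoot (P.weylGroupToPerm g i) ↔ P.IsShortRoot i := by
  simp only [IsShortRoot, hP.norm_root_weylGroupToPerm]

open scoped Classical in
lemma sum_ite_isShortRoot_smul (s : Finset ι) (p q : ℝ) :
    ∑ i ∈ s, (if P.IsShortRoot i then p else q) • P.root i =
      p • ∑ i ∈ s with P.IsShortRoot i, P.root i +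
        q • ∑ i ∈ s with ¬ P.IsShortRoot i, P.root i := by
  rw [Finset.smul_sum, Finset.smul_sum, Finset.sum_filter, Finset.sum_filter,
    ← Finset.sum_add_distrib]
  refine Finset.sum_congr rfl fun i _ ↦ ?_
  split_ifs <;> simp_all

/-- If `w • x - x` has nonnegative scalar product with `x`, then `w` fixes `x`. -/
lemma smul_eq_self_of_inner_nonneg (hP : P.IsEuclidean) {x : E} {w : P.weylGroup}
    (h : (0 : ℝ) ≤ inner ℝ x (w • x - x)) : w • x = x := by
  -- Since w is an isometry, ‖wx - x‖² = -2⟨x, wx - x⟩ ≤ 0.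
  rw [← sub_eq_zero, ← norm_eq_zero, ← sq_eq_zero_iff, ← real_inner_self_eq_norm_sq]
  refine le_antisymm ?_ real_inner_self_nonneg
  rw [inner_sub_right] at h
  simp only [inner_sub_left, inner_sub_right, hP.inner_weylGroup_smul_smul,
    real_inner_comm x (w • x)]
  rw [real_inner_comm] at h
  linarith [real_inner_comm x (w • x)]

variable [Fintype ι] (b : P.Base)

/-! ### Inversion sets and the weighted half-sum -/

lemma mem_posRoots {i : ι} : i ∈ posRoots b ↔ b.IsPos i := by
  simp [posRoots]

lemma mem_inversionSet {w : P.weylGroup} {i : ι} :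
    i ∈ inversionSet b w ↔ b.IsPos i ∧ ¬ b.IsPos (P.weylGroupToPerm w i) := by
  simp only [inversionSet, Finset.mem_filter, mem_posRoots, weylGroup_apply_root, Set.mem_image,
    Set.mem_ofPred_eq, EmbeddingLike.apply_eq_iff_eq, exists_eq_right]

open scoped Classical in
lemma sum_inversionSet (w : P.weylGroup) (f : ι → E) :
    ∑ i ∈ inversionSet b w, f i =
      ∑ i ∈ posRoots b, if b.IsPos (P.weylGroupToPerm w i) then 0 else f i := by
  have h : inversionSet b w = {i ∈ posRoots b | ¬ b.IsPos (P.weylGroupToPerm w i)} := by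
    ext i
    simp [mem_inversionSet, mem_posRoots]
  rw [h, Finset.sum_filter]
  exact Finset.sum_congr rfl fun i _ ↦ by split_ifs <;> rfl

/-- A sum over all roots of a summand that is invariant under negation is twice the sum over the
positive roots. -/
lemma sum_eq_two_smul_sum_posRoots [P.IsReduced] (f : ι → E)
    (hf : ∀ i, f (P.reflectionPerm i i) = f i) :
    ∑ i, f i = (2 : ℝ) • ∑ i ∈ posRoots b, f i := by
  classical
  let := P.indexNeg
  have h : ∑ i ∈ Finset.univ.filter (fun i ↦ ¬ b.IsPos i), f i = ∑ i ∈ posRoots b, f i := by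
    refine Finset.sum_nbij' (fun i ↦ -i) (fun i ↦ -i) ?_ ?_ ?_ ?_ ?_
    · intro i hi
      exact (mem_posRoots b).2 ((Base.IsPos.neg_iff_not b i).2 (Finset.mem_filter.1 hi).2)
    · intro i hi
      refine Finset.mem_filter.2 ⟨Finset.mem_univ _, fun h ↦ ?_⟩
      exact (Base.IsPos.neg_iff_not b i).1 h ((mem_posRoots b).1 hi)
    · intro i _
      exact neg_neg i
    · intro i _
      exact neg_neg i
    · intro i _
      exact (hf i).symm
  have h' := Finset.sum_filter_add_sum_filter_not Finset.univ (fun i ↦ b.IsPos i) f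
  rw [h] at h'
  rw [← h', two_smul]
  congr 1

/-- The half-sum of the positive roots, the root `i` being weighted by `c i`. -/
noncomputable def weightedRho (c : ι → ℝ) : E := (1 / 2 : ℝ) • ∑ i ∈ posRoots b, c i • P.root i

/-- Negating a root flips both the sign and the root, and leaves `c` alone because the reflection in
a root negates it; so opposite roots contribute equally. -/
lemma sum_sign_smul_root [P.IsReduced] [DecidablePred b.IsPos] (c : ι → ℝ)
    (hc : ∀ (g : P.weylGroup) i, c (P.weylGroupToPerm g i) = c i) (w : P.weylGroup) :
    ∑ i, (if b.IsPos (P.weylGroupToPerm w i) then (1 : ℝ) else -1) • c i • P.root i =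
      (2 : ℝ) • ∑ i ∈ posRoots b,
        (if b.IsPos (P.weylGroupToPerm w i) then (1 : ℝ) else -1) • c i • P.root i := by
  let := P.indexNeg
  refine sum_eq_two_smul_sum_posRoots b _ fun i ↦ ?_
  have h1 : c (P.reflectionPerm i i) = c i := by
    simpa [weylGroup.ofIdx] using hc (weylGroup.ofIdx P i) i
  have h2 : P.weylGroupToPerm w (P.reflectionPerm i i) = -(P.weylGroupToPerm w i) := by
    apply P.root.injective
    rw [← weylGroup_apply_root, indexNeg_neg, root_reflectionPerm, root_reflectionPerm,
      reflection_apply_self, reflection_apply_self, smul_neg, weylGroup_apply_root]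
  simp only [h1, h2, Base.IsPos.neg_iff_not, root_reflectionPerm, reflection_apply_self]
  split_ifs <;> first | contradiction | module

/-- Reindexing along w turns 4ρ and 4w⁻¹ρ into sums over all roots of ±c_α α, signed by α and by wα
respectively. On positive roots the signs differ exactly at the inversions. -/
lemma weightedRho_sub_inv_smul [P.IsReduced] (c : ι → ℝ)
    (hc : ∀ (g : P.weylGroup) i, c (P.weylGroupToPerm g i) = c i) (w : P.weylGroup) :
    weightedRho b c - w⁻¹ • weightedRho b c = ∑ i ∈ inversionSet b w, c i • P.root i := by
  classical
  have hρ : (4 : ℝ) • weightedRho b c =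
      ∑ i, (if b.IsPos i then (1 : ℝ) else -1) • c i • P.root i := by
    have h := sum_sign_smul_root b c hc 1
    simp only [map_one, Equiv.Perm.coe_one, id_eq] at h
    have h' : ∑ i ∈ posRoots b, (if b.IsPos i then (1 : ℝ) else -1) • c i • P.root i =
        ∑ i ∈ posRoots b, c i • P.root i :=
      Finset.sum_congr rfl fun i hi ↦ by rw [if_pos ((mem_posRoots b).1 hi), one_smul]
    rw [h, h', weightedRho, smul_smul]
    norm_num
  have hw : (4 : ℝ) • w⁻¹ • weightedRho b c =
      ∑ i, (if b.IsPos (P.weylGroupToPerm w i) then (1 : ℝ) else -1) • c i • P.root i := by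
    rw [← smul_comm w⁻¹ (4 : ℝ), hρ, Finset.smul_sum]
    refine (Finset.sum_equiv (P.weylGroupToPerm w) (by simp) fun i _ ↦ ?_).symm
    rw [hc, smul_comm w⁻¹, smul_comm w⁻¹, ← weylGroup_apply_root, inv_smul_smul]
  rw [sum_sign_smul_root b c hc w] at hw
  have hs := sum_inversionSet b w fun i ↦ c i • P.root i
  have hd : weightedRho b c - (1 / 2 : ℝ) • ∑ i ∈ posRoots b,
        (if b.IsPos (P.weylGroupToPerm w i) then (1 : ℝ) else -1) • c i • P.root i =
      ∑ i ∈ inversionSet b w, c i • P.root i := by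
    rw [hs, weightedRho, Finset.smul_sum, Finset.smul_sum, ← Finset.sum_sub_distrib]
    refine Finset.sum_congr rfl fun i _ ↦ ?_
    split_ifs <;> module
  rw [← hd]
  congr 1
  have : w⁻¹ • weightedRho b c = (1 / 4 : ℝ) • (4 : ℝ) • w⁻¹ • weightedRho b c := by
    rw [smul_smul]; norm_num
  rw [this, hw, smul_smul]
  norm_num

/-- A simple reflection inverts only its own root, so it moves ρ by exactly `c j` times that root.
-/
lemma inner_weightedRho_coroot [P.IsCrystallographic] [P.IsReduced] (hP : P.IsEuclidean) (c : ι → ℝ)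
    (hc : ∀ (g : P.weylGroup) i, c (P.weylGroupToPerm g i) = c i) {j : ι} (hj : j ∈ b.support) :
    inner ℝ (weightedRho b c) (P.coroot j) = c j := by
  have hinv : (weylGroup.ofIdx P j)⁻¹ = weylGroup.ofIdx P j :=
    Subtype.ext (Equiv.reflection_inv P j)
  have hset : inversionSet b (weylGroup.ofIdx P j) = {j} := by
    let := P.indexNeg
    ext i
    have hperm : P.weylGroupToPerm (weylGroup.ofIdx P j) i = P.reflectionPerm j i := by
      simp [weylGroup.ofIdx]
    rw [mem_inversionSet, hperm, Finset.mem_singleton]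
    refine ⟨fun h ↦ ?_, ?_⟩
    · by_contra hij
      exact h.2 (h.1.reflectionPerm hj hij)
    · rintro rfl
      have := Base.isPos_of_mem_support hj
      exact ⟨this, fun h ↦ (Base.IsPos.neg_iff_not b i).1 h this⟩
  have h := weightedRho_sub_inv_smul b c hc (weylGroup.ofIdx P j)
  have hrefl : weylGroup.ofIdx P j • weightedRho b c =
      weightedRho b c - (inner ℝ (weightedRho b c) (P.coroot j) : ℝ) • P.root j := by
    rw [← hP.toLinearMap_apply]
    exact P.reflection_apply j _
  rw [hset, hinv, hrefl, Finset.sum_singleton, sub_sub_cancel] at h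
  exact smul_left_injective ℝ (P.ne_zero j) h

/-! ### Dominance and the orbit criterion -/

/-- A vector whose scalar products with the simple coroots are nonnegative has nonnegative scalar
product with all positive roots. -/
lemma inner_root_nonneg_of_isPos [P.IsCrystallographic] (hP : P.IsEuclidean) {x : E}
    (hx : ∀ j ∈ b.support, (0 : ℝ) ≤ inner ℝ x (P.coroot j)) {i : ι} (hi : b.IsPos i) :
    (0 : ℝ) ≤ inner ℝ x (P.root i) := by
  have hs : ∀ j ∈ b.support, (0 : ℝ) ≤ inner ℝ x (P.root j) := by
    intro j hj
    have h := hx j hj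
    have hpos : (0 : ℝ) < inner ℝ (P.root j) (P.root j) := real_inner_self_pos.2 (P.ne_zero j)
    rw [hP.coroot_eq, real_inner_smul_right] at h
    exact nonneg_of_mul_nonneg_right h (by positivity)
  refine hi.induction_on_add hs fun i j k hk hi hj ↦ ?_
  rw [hk, inner_add_right]
  exact add_nonneg hi (hs j hj)

/-- Let `c` be a Weyl group invariant weight on the roots with `c j ≤ ⟨x, α_j^∨⟩` for the simple
roots, and let `0 ≤ n i ≤ c i` for the positive roots. Then `x` minus the `n`-weighted sum of the
positive roots lies in the Weyl group orbit of `x` if and only if it is `x` minus the `c`-weighted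
sum over the inversion set of an element of the stabilizer of `x - weightedRho b c`. -/
theorem sub_sum_mem_orbit_iff [P.IsCrystallographic] [P.IsReduced] (hP : P.IsEuclidean)
    (c : ι → ℝ) (hc : ∀ (g : P.weylGroup) i, c (P.weylGroupToPerm g i) = c i) (x : E)
    (hx : ∀ j ∈ b.support, c j ≤ inner ℝ x (P.coroot j)) (n : ι → ℝ)
    (hn : ∀ i, b.IsPos i → 0 ≤ n i ∧ n i ≤ c i) :
    x - ∑ i ∈ posRoots b, n i • P.root i ∈ MulAction.orbit P.weylGroup x ↔
      ∃ w ∈ MulAction.stabilizer P.weylGroup (x - weightedRho b c),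
        x - ∑ i ∈ posRoots b, n i • P.root i =
          x - ∑ i ∈ inversionSet b w, c i • P.root i := by
  classical
  constructor
  · rintro ⟨g, hg⟩
    -- The inverse appears because `inversionSet b w` governs ρ - w⁻¹ρ.
    obtain ⟨w, rfl⟩ : ∃ w, g = w⁻¹ := ⟨g⁻¹, by simp⟩
    replace hg : w⁻¹ • x = x - ∑ i ∈ posRoots b, n i • P.root i := hg
    have hρ := weightedRho_sub_inv_smul b c hc w
    have hdom {i : ι} (hi : b.IsPos i) : (0 : ℝ) ≤ inner ℝ (x - weightedRho b c) (P.root i) := by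
      refine inner_root_nonneg_of_isPos b hP (fun j hj ↦ ?_) hi
      rw [inner_sub_left, inner_weightedRho_coroot b hP c hc hj]
      exact sub_nonneg.2 (hx j hj)
    have hsum := sum_inversionSet b w fun i ↦ c i • P.root i
    have hdiff : (x - weightedRho b c) - w⁻¹ • (x - weightedRho b c) =
        ∑ i ∈ posRoots b,
          (n i - if b.IsPos (P.weylGroupToPerm w i) then 0 else c i) • P.root i := by
      have : ∑ i ∈ posRoots b,
          (n i - if b.IsPos (P.weylGroupToPerm w i) then 0 else c i) • P.root i =
          ∑ i ∈ posRoots b, n i • P.root i - ∑ i ∈ inversionSet b w, c i • P.root i := by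
        rw [hsum, ← Finset.sum_sub_distrib]
        refine Finset.sum_congr rfl fun i _ ↦ ?_
        split_ifs <;> module
      rw [this, ← hρ, smul_sub, hg]
      abel
    have hfix : w • (x - weightedRho b c) = x - weightedRho b c := by
      refine smul_eq_self_of_inner_nonneg hP ?_
      have hw : w • (x - weightedRho b c) - (x - weightedRho b c) = ∑ i ∈ posRoots b,
          (n i - if b.IsPos (P.weylGroupToPerm w i) then 0 else c i) •
            P.root (P.weylGroupToPerm w i) := by
        have := congrArg (w • ·) hdiff
        rw [smul_sub, smul_inv_smul, Finset.smul_sum] at this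
        rw [this]
        exact Finset.sum_congr rfl fun i _ ↦ by rw [smul_comm, weylGroup_apply_root]
      rw [hw, inner_sum]
      refine Finset.sum_nonneg fun i hi ↦ ?_
      rw [mem_posRoots] at hi
      rw [real_inner_smul_right]
      split_ifs with h
      · exact mul_nonneg (by simpa using (hn i hi).1) (hdom h)
      · refine mul_nonneg_of_nonpos_of_nonpos (by simpa using (hn i hi).2) ?_
        let := P.indexNeg
        have := hdom ((Base.IsPos.neg_iff_not b _).2 h)
        rw [indexNeg_neg, root_reflectionPerm, reflection_apply_self, inner_neg_right] at this
        linarith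
    refine ⟨w, hfix, ?_⟩
    -- As w⁻¹ fixes x - ρ, it displaces x exactly as it displaces ρ.
    rw [← hρ, ← hg, ← sub_add]
    calc w⁻¹ • x = w⁻¹ • (x - weightedRho b c) + w⁻¹ • weightedRho b c := by
          rw [← smul_add, sub_add_cancel]
      _ = x - weightedRho b c + w⁻¹ • weightedRho b c := by rw [inv_smul_eq_iff.2 hfix.symm]
  · rintro ⟨w, hw, h⟩
    refine ⟨w⁻¹, ?_⟩
    have hfix : w⁻¹ • (x - weightedRho b c) = x - weightedRho b c :=
      inv_smul_eq_iff.2 (MulAction.mem_stabilizer_iff.1 hw).symm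
    change w⁻¹ • x = _
    rw [h, ← weightedRho_sub_inv_smul b c hc w, ← sub_add, eq_comm]
    calc x - weightedRho b c + w⁻¹ • weightedRho b c
        = w⁻¹ • (x - weightedRho b c) + w⁻¹ • weightedRho b c := by rw [hfix]
      _ = w⁻¹ • x := by rw [← smul_add, sub_add_cancel]

end InvariantWeights

end RootPairing

theorem proposition5p7 {ι E : Type*} [Fintype ι] [DecidableEq ι]
    [NormedAddCommGroup E] [InnerProductSpace ℝ E] [FiniteDimensional ℝ E]
    (P : RootPairing ι ℝ E E) (hP : P.IsEuclidean)
    [P.IsRootSystem] [P.IsCrystallographic] [P.IsReduced] [P.IsIrreducible]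
    (b : P.Base) (lam : E) (hlam : RootPairing.IsStronglyDominant b lam)
    (ms ml : ℝ) (hms : 0 < ms) (hml : 0 < ml)
    (hms' : (ms : WithTop ℝ) ≤ RootPairing.minShort b lam)
    (hml' : (ml : WithTop ℝ) ≤ RootPairing.minLong b lam)
    (n : ι → ℤ)
    (hns : ∀ i ∈ RootPairing.shortPosRoots b, 0 ≤ n i ∧ (n i : ℝ) ≤ ms)
    (hnl : ∀ i ∈ RootPairing.longPosRoots b, 0 ≤ n i ∧ (n i : ℝ) ≤ ml) :
    lam - ∑ i ∈ RootPairing.posRoots b, n i • P.root i ∈ MulAction.orbit P.weylGroup lam ↔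
      ∃ w ∈ MulAction.stabilizer P.weylGroup
          (lam - ms • RootPairing.rhoShort b - ml • RootPairing.rhoLong b),
        lam - ∑ i ∈ RootPairing.posRoots b, n i • P.root i =
          lam - ms • ∑ i ∈ RootPairing.inversionSet b w ∩ RootPairing.shortPosRoots b, P.root i
            - ml • ∑ i ∈ RootPairing.inversionSet b w ∩ RootPairing.longPosRoots b, P.root i := by
  classical
  -- Invariant because the Weyl group preserves root lengths.
  let c : ι → ℝ := fun i ↦ if P.IsShortRoot i then ms else ml
  have hc (g : P.weylGroup) (i : ι) : c (P.weylGroupToPerm g i) = c i := by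
    simp only [c, hP.isShortRoot_weylGroupToPerm_iff]
  have hshort {i : ι} (hi : b.IsPos i) (h : P.IsShortRoot i) : i ∈ RootPairing.shortPosRoots b := by
    simp [RootPairing.shortPosRoots, RootPairing.mem_posRoots, hi, h]
  have hlong {i : ι} (hi : b.IsPos i) (h : ¬ P.IsShortRoot i) :
      i ∈ RootPairing.longPosRoots b := by
    simp [RootPairing.longPosRoots, RootPairing.mem_posRoots, hi, h]
  have hx : ∀ j ∈ b.support, c j ≤ inner ℝ lam (P.coroot j) := by
    intro j hj
    have hj' := RootPairing.Base.isPos_of_mem_support hj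
    by_cases h : P.IsShortRoot j
    · simpa [c, h] using WithTop.coe_le_coe.1 (hms'.trans (Finset.inf_le (hshort hj' h)))
    · simpa [c, h] using WithTop.coe_le_coe.1 (hml'.trans (Finset.inf_le (hlong hj' h)))
  have hn (i : ι) (hi : b.IsPos i) : (0 : ℝ) ≤ n i ∧ (n i : ℝ) ≤ c i := by
    by_cases h : P.IsShortRoot i
    · simpa [c, h] using hns i (hshort hi h)
    · simpa [c, h] using hnl i (hlong hi h)
  have hρ : lam - ms • RootPairing.rhoShort b - ml • RootPairing.rhoLong b =
      lam - RootPairing.weightedRho b c := by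
    rw [RootPairing.weightedRho, RootPairing.sum_ite_isShortRoot_smul, sub_sub,
      RootPairing.rhoShort, RootPairing.rhoLong, smul_add, smul_comm ms, smul_comm ml]
    rfl
  have hS (w : P.weylGroup) :
      ∑ i ∈ RootPairing.inversionSet b w, c i • P.root i =
        ms • ∑ i ∈ RootPairing.inversionSet b w ∩ RootPairing.shortPosRoots b, P.root i
          + ml • ∑ i ∈ RootPairing.inversionSet b w ∩ RootPairing.longPosRoots b, P.root i := by
    rw [RootPairing.sum_ite_isShortRoot_smul]
    congr 3 <;> ext i <;>
      simp +contextual [RootPairing.mem_inversionSet, RootPairing.mem_posRoots,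
        RootPairing.shortPosRoots, RootPairing.longPosRoots]
  have main := RootPairing.sub_sum_mem_orbit_iff b hP c hc lam hx (fun i ↦ (n i : ℝ)) hn
  simp only [Int.cast_smul_eq_zsmul, hS] at main
  simpa only [hρ, sub_sub] using main
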